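/- Let $0<R_1\le R_2\le D$, $\lambda\ge 0$, $s>0$, and let $\Phi$ be a homogeneous Poisson point process of intensity $\lambda$ on the closed disk $\mathcal B(o,D)\subset\mathbb R^2$. Given $\Phi$, each node $x\in\Phi$ becomes a jammer independently of the others, with probability $1$ if $\|x\|\le R_1$, with probability $P(\|x\|)$ if $R_1<\|x\|\le R_2$, and with probability $0$ if $\|x\|>R_2$; let $\Phi_J$ be the set of jammers. The selection policies are, for path-loss exponent $\alpha=2$, $$\text{E: } P(r)=p\ \ (p\in[0,1]),\qquad \text{I: } P(r)=\frac{r^2-R_1^2}{R_2^2-R_1^2},\qquad \text{D: } P(r)=\frac{R_2^2-r^2}{R_2^2-R_1^2}.$$ Let $I(y)=\sum_{x\in\Phi_J}h_{x,y}\|x-y\|^{-2}$, where the $h_{x,y}$ are i.i.d. exponential random variables of mean $1$, independent of $\Phi$ and of the selection, and let $\mathcal L^{\Xi,2}_{I(y)}(s)=\mathbb E[e^{-sI(y)}]$ under policy $\Xi$. Let $y\in\mathcal B(o,D)$, $y\ne o$, and write $a(r)=\operatorname{arcsinh}\frac{s+r^2-\|y\|^2}{2\|y\|\sqrt s}$,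 where $\operatorname{arcsinh}t=\ln(t+\sqrt{t^2+1})$. Then $$\mathcal L^{\mathrm E,2}_{I(y)}(s)=\exp\Big\{-\lambda\pi s\Big[p\,a(R_2)+(1-p)\,a(R_1)-\ln\frac{\sqrt s}{\|y\|}\Big]\Big\},$$ and for $\Xi'\in\{\mathrm I,\mathrm D\}$ $$\mathcal L^{\Xi',2}_{I(y)}(s)=\exp\Big\{-\lambda\pi s\Big[\Psi_2^{\Xi'}(R_2,s,\|y\|)-\Psi_2^{\Xi'}(R_1,s,\|y\|)+a(R_1)-\ln\frac{\sqrt s}{\|y\|}\Big]\Big\},$$ where $$\Psi_2^{\mathrm I}(r,s,\|y\|)=\frac{\sqrt{r^4+2(s-\|y\|^2)r^2+(s+\|y\|^2)^2}}{R_2^2-R_1^2}-\frac{s+R_1^2-\|y\|^2}{R_2^2-R_1^2}\,a(r),$$ $$\Psi_2^{\mathrm D}(r,s,\|y\|)=\frac{s+R_2^2-\|y\|^2}{R_2^2-R_1^2}\,a(r)-\frac{\sqrt{r^4+2(s-\|y\|^2)r^2+(s+\|y\|^2)^2}}{R_2^2-R_1^2}.$$ For $R_1=R_2$ the annulus is empty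 and $\Psi_2^{\Xi'}(R_2,\cdot)-\Psi_2^{\Xi'}(R_1,\cdot)$ is read as $0$. For $y=o$, where the right-hand sides are not defined as written, $\mathcal L^{\Xi,2}_{I(o)}(s)$ is, for each policy, the limit of the right-hand side as $\|y\|$ is replaced by $\rho\to0^+$. -/

import Mathlib

open MeasureTheory ProbabilityTheory Filter Topology

namespace Jamming

/-- The plane with its Euclidean norm. -/
abbrev Plane : Type := EuclideanSpace ℝ (Fin 2)

section Model

variable {Ω : Type*} [MeasurableSpace Ω]

/-- The number of points in `B` of the random finite configuration `{X 0, …, X (N - 1)}`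
(`X i` is a mere placeholder for `N ≤ i`). -/
noncomputable def count (N : Ω → ℕ) (X : ℕ → Ω → Plane) (B : Set Plane) (ω : Ω) : ℕ := by
  classical exact ((Finset.range (N ω)).filter (fun i => X i ω ∈ B)).card

/-- `{X 0, …, X (N - 1)}` is a Poisson point process with (finite) intensity measure `Λ`:
the number of points in `B` is Poisson with mean `Λ B`, and the numbers of points in pairwise
disjoint sets are independent. -/
structure IsPoissonProcess (μ : Measure Ω) (Λ : Measure Plane)
    (N : Ω → ℕ) (X : ℕ → Ω → Plane) : Prop where
  measurable_card : Measurable N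
  measurable_point : ∀ i, Measurable (X i)
  law_count : ∀ B : Set Plane, MeasurableSet B →
    HasLaw (count N X B) (poissonMeasure (Λ B).toNNReal) μ
  indep_count : ∀ (n : ℕ) (B : Fin n → Set Plane), (∀ k, MeasurableSet (B k)) →
    Pairwise (fun k l => Disjoint (B k) (B l)) → iIndepFun (fun k => count N X (B k)) μ

/-- The σ-algebra generated by the configuration. -/
abbrev sigmaPoints (N : Ω → ℕ) (X : ℕ → Ω → Plane) : MeasurableSpace Ω :=
  MeasurableSpace.comap (fun ω => (N ω, fun i => X i ω)) inferInstance

/-- The marks `J` select a location-dependent independent thinning of the configuration with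
retention probability `q`: conditionally on the configuration, the points `X i`, `i < N`, are
selected (`J i = true`) independently of each other, `X i` with probability `q (X i)`. -/
structure IsIndependentThinning (μ : Measure Ω) (N : Ω → ℕ) (X : ℕ → Ω → Plane)
    (q : Plane → ℝ) (J : ℕ → Ω → Bool) : Prop where
  measurable_mark : ∀ i, Measurable (J i)
  cond_prob : ∀ S : Finset ℕ,
    μ[({ω | ∀ i ∈ S, i < N ω ∧ J i ω = true}).indicator (fun _ => (1 : ℝ)) | sigmaPoints N X]
      =ᵐ[μ] fun ω => ∏ i ∈ S, if i < N ω then q (X i ω) else 0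

/-- Rayleigh fading of unit mean: the power gains `h i` are i.i.d. exponential with mean `1` and
independent of the configuration and of the selection. -/
structure IsRayleighFading (μ : Measure Ω) (N : Ω → ℕ) (X : ℕ → Ω → Plane)
    (J : ℕ → Ω → Bool) (h : ℕ → Ω → ℝ) : Prop where
  measurable_gain : ∀ i, Measurable (h i)
  law_gain : ∀ i, HasLaw (h i) (expMeasure 1) μ
  indep_gain : iIndepFun h μ
  indep_network : IndepFun (fun ω i => h i ω)
    (fun ω => (N ω, (fun i => X i ω), (fun i => J i ω))) μ

/-- The sum interference at `y`: the sum of `h i * ‖X i - y‖ ^ (-α)` over the selected points. -/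
noncomputable def interference (α : ℝ) (N : Ω → ℕ) (X : ℕ → Ω → Plane) (J : ℕ → Ω → Bool)
    (h : ℕ → Ω → ℝ) (y : Plane) (ω : Ω) : ℝ :=
  ∑ i ∈ (Finset.range (N ω)).filter (fun i => J i ω = true), h i ω * ‖X i ω - y‖ ^ (-α)

/-- The Laplace transform `s ↦ 𝔼[exp (-s I)]` of a random variable. -/
noncomputable def laplaceTransform (μ : Measure Ω) (I : Ω → ℝ) (s : ℝ) : ℝ :=
  ∫ ω, Real.exp (-s * I ω) ∂μ

end Model

/-- The selection policies for long-range jammers. -/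
inductive Policy : Type
  | E (p : ℝ)
  | I
  | D

/-- The selection probability of a node at distance `r` in the annulus. -/
noncomputable def Policy.prob (α R₁ R₂ : ℝ) : Policy → ℝ → ℝ
  | .E p, _ => p
  | .I, r => (r ^ α - R₁ ^ α) / (R₂ ^ α - R₁ ^ α)
  | .D, r => (R₂ ^ α - r ^ α) / (R₂ ^ α - R₁ ^ α)

/-- The probability that a node at `x` becomes a jammer: `1` in the friendship circle, the
policy's probability in the friendship annulus, and `0` elsewhere. -/
noncomputable def jamProb (α R₁ R₂ : ℝ) (Ξ : Policy) (x : Plane) : ℝ :=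
  if ‖x‖ ≤ R₁ then 1 else if ‖x‖ ≤ R₂ then Ξ.prob α R₁ R₂ ‖x‖ else 0

/-- The term `arcsinh ((s + r² - ρ²) / (2 ρ √s))`. -/
noncomputable def asTerm (r s ρ : ℝ) : ℝ :=
  Real.arsinh ((s + r ^ 2 - ρ ^ 2) / (2 * ρ * √s))

/-- `Ψ₂ᴵ(r, s, ρ)`. -/
noncomputable def PsiI (R₁ R₂ r s ρ : ℝ) : ℝ :=
  √(r ^ 4 + 2 * (s - ρ ^ 2) * r ^ 2 + (s + ρ ^ 2) ^ 2) / (R₂ ^ 2 - R₁ ^ 2)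
    - (s + R₁ ^ 2 - ρ ^ 2) / (R₂ ^ 2 - R₁ ^ 2) * asTerm r s ρ

/-- `Ψ₂ᴰ(r, s, ρ)`. -/
noncomputable def PsiD (R₁ R₂ r s ρ : ℝ) : ℝ :=
  (s + R₂ ^ 2 - ρ ^ 2) / (R₂ ^ 2 - R₁ ^ 2) * asTerm r s ρ
    - √(r ^ 4 + 2 * (s - ρ ^ 2) * r ^ 2 + (s + ρ ^ 2) ^ 2) / (R₂ ^ 2 - R₁ ^ 2)

/-- The closed form, for path-loss exponent `2`, at distance `ρ` from the origin. -/
noncomputable def closedForm (lam R₁ R₂ s : ℝ) : Policy → ℝ → ℝ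
  | .E p, ρ => Real.exp (-(lam * Real.pi * s *
      (p * asTerm R₂ s ρ + (1 - p) * asTerm R₁ s ρ - Real.log (√s / ρ))))
  | .I, ρ => Real.exp (-(lam * Real.pi * s *
      (PsiI R₁ R₂ R₂ s ρ - PsiI R₁ R₂ R₁ s ρ + (asTerm R₁ s ρ - Real.log (√s / ρ)))))
  | .D, ρ => Real.exp (-(lam * Real.pi * s *
      (PsiD R₁ R₂ R₂ s ρ - PsiD R₁ R₂ R₁ s ρ + (asTerm R₁ s ρ - Real.log (√s / ρ)))))

end Jamming

/-! ### Probability: from the interference to an exponential of a plane integral. -/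

namespace Jamming

/-! Averaging over the fading turns each selected point into a factor `(1 + s‖x - y‖⁻²)⁻¹ = 1 - g x`
(`IsRayleighFading.laplaceTransform_interference`). Averaging over the selection replaces this by `1
- g x * q x`, where `q` is the selection probability (`IsIndependentThinning.integral_prod`). The
generating functional of a Poisson process (`IsPoissonProcess.integral_prod`) then gives `exp (-∫ g
q dΛ)`.

It remains to integrate `s / (s + ‖x - y‖²)` against a radial weight. In polar coordinates the
angular integral is elementary (`integral_one_div_sub_mul_cos`) and leaves the radial kernel `2r /
√(radialDisc s ρ r)` with `ρ = ‖y‖`. For `ρ > 0` this kernel is the derivative of `asTerm`, and `(s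
+ r² - ρ²)` times it is the derivative of `√radialDisc`. Each policy is affine in `r²`, so these two
antiderivatives suffice.

The radial integral stays continuous at `ρ = 0`, although the closed form is not defined there; this
yields the limit for `y = 0`. -/

theorem measurable_prod_range {β : Type*} [MeasurableSpace β] {N : β → ℕ} (hN : Measurable N)
    {f : ℕ → β → ℝ} (hf : ∀ i, Measurable (f i)) :
    Measurable fun b => ∏ i ∈ Finset.range (N b), f i b := by
  have h : Measurable fun p : ℕ × β => ∏ i ∈ Finset.range p.1, f i p.2 :=
    measurable_from_prod_countable_right fun n =>
      Finset.measurable_prod (Finset.range n) fun i _ => hf i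
  exact h.comp (hN.prodMk measurable_id)

theorem integral_pow_poissonMeasure (r : NNReal) (t : ℝ) :
    ∫ n, t ^ n ∂(poissonMeasure r) = Real.exp (-((r : ℝ) * (1 - t))) := by
  rw [integral_poissonMeasure]
  have h := (NormedSpace.expSeries_div_hasSum_exp ((r : ℝ) * t)).mul_left (Real.exp (-(r : ℝ)))
  rw [← Real.exp_eq_exp_ℝ, ← Real.exp_add] at h
  have e : -((r : ℝ) * (1 - t)) = -(r : ℝ) + r * t := by ring
  rw [e, ← h.tsum_eq]
  congr 1
  ext n
  rw [smul_eq_mul, mul_pow]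
  ring

/-- Clipping at `0` changes nothing almost everywhere for the exponential law, but keeps the
integrand in `[0, 1]` everywhere, so that Fubini needs no separate integrability argument. -/
theorem integral_exp_neg_mul_max_expMeasure {c : ℝ} (hc : 0 ≤ c) :
    ∫ x, Real.exp (-(c * max x 0)) ∂(expMeasure 1) = (1 + c)⁻¹ := by
  have hd : expMeasure 1 = volume.withDensity (exponentialPDF 1) := rfl
  have hm : Measurable (exponentialPDF 1) := (measurable_exponentialPDFReal 1).ennreal_ofReal
  rw [hd, integral_withDensity_eq_integral_toReal_smul hm
    (ae_of_all _ fun x => ENNReal.ofReal_lt_top)]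
  have h1 : (fun x : ℝ => (exponentialPDF 1 x).toReal • Real.exp (-(c * max x 0)))
      = (Set.Ici (0 : ℝ)).indicator fun x => Real.exp (-(1 + c) * x) := by
    ext x
    by_cases hx : 0 ≤ x
    · rw [Set.indicator_of_mem (by exact hx), exponentialPDF_of_nonneg hx, max_eq_left hx,
        ENNReal.toReal_ofReal (by positivity), smul_eq_mul, one_mul, one_mul, ← Real.exp_add]
      congr 1
      ring
    · rw [Set.indicator_of_notMem (by exact hx), exponentialPDF_of_neg (not_le.mp hx)]
      simp
  rw [h1, integral_indicator measurableSet_Ici, integral_Ici_eq_integral_Ioi,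
    integral_exp_mul_Ioi (by linarith)]
  rw [mul_zero, Real.exp_zero, neg_div_neg_eq, one_div]

theorem ae_nonneg_expMeasure : ∀ᵐ x ∂(expMeasure 1), 0 ≤ x := by
  have hd : expMeasure 1 = volume.withDensity (exponentialPDF 1) := rfl
  have hs : {x : ℝ | ¬ 0 ≤ x} = Set.Iio 0 := by ext x; simp
  rw [ae_iff, hs, hd, withDensity_apply _ measurableSet_Iio]
  exact lintegral_exponentialPDF_of_nonpos le_rfl

section Model

variable {Ω : Type*} [MeasurableSpace Ω] {μ : Measure Ω}

/-- Reduces a product over a random number of points to products of fixed length, since `N` takes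
countably many values. -/
theorem integral_eq_of_forall_fiber {N : Ω → ℕ} (hN : Measurable N) {F G : Ω → ℝ}
    (hF : Integrable F μ) (hG : Integrable G μ)
    (h : ∀ n, ∫ ω in N ⁻¹' {n}, F ω ∂μ = ∫ ω in N ⁻¹' {n}, G ω ∂μ) :
    ∫ ω, F ω ∂μ = ∫ ω, G ω ∂μ := by
  have hm : ∀ n, MeasurableSet (N ⁻¹' {n}) := fun n => hN (measurableSet_singleton n)
  have hd : Pairwise (Function.onFun Disjoint fun n => N ⁻¹' ({n} : Set ℕ)) := fun i j hij =>
    Disjoint.preimage _ (by simpa using hij)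
  have hu : (⋃ n, N ⁻¹' ({n} : Set ℕ)) = Set.univ := by
    ext ω; simp
  have h1 := hasSum_integral_iUnion hm hd (hF.integrableOn (s := ⋃ n, N ⁻¹' ({n} : Set ℕ)))
  have h2 := hasSum_integral_iUnion hm hd (hG.integrableOn (s := ⋃ n, N ⁻¹' ({n} : Set ℕ)))
  rw [hu, Measure.restrict_univ] at h1 h2
  simp_rw [h] at h1
  exact h1.unique h2

theorem integrable_prod_range [IsFiniteMeasure μ] {N : Ω → ℕ} (hN : Measurable N)
    {f : ℕ → Ω → ℝ} (hf : ∀ i, Measurable (f i)) (h0 : ∀ i ω, |f i ω| ≤ 1) :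
    Integrable (fun ω => ∏ i ∈ Finset.range (N ω), f i ω) μ := by
  refine Integrable.of_bound (measurable_prod_range hN hf).aestronglyMeasurable 1
    (ae_of_all _ fun ω => ?_)
  rw [Real.norm_eq_abs, Finset.abs_prod]
  exact Finset.prod_le_one (fun i _ => abs_nonneg _) fun i _ => h0 i ω

/-- The probability generating functional on simple functions. -/
theorem IsPoissonProcess.integral_prod_simpleFunc [IsProbabilityMeasure μ] {Λ : Measure Plane}
    [IsFiniteMeasure Λ] {N : Ω → ℕ} {X : ℕ → Ω → Plane} (hΦ : IsPoissonProcess μ Λ N X)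
    (f : SimpleFunc Plane ℝ) :
    ∫ ω, ∏ i ∈ Finset.range (N ω), f (X i ω) ∂μ = Real.exp (-∫ x, (1 - f x) ∂Λ) := by
  classical
  set m := f.range.card with hm
  let e : f.range ≃ Fin m := f.range.equivFin
  -- On the level sets of `f` the product becomes a product of powers `c ^ count`, whose exponents
  -- are independent Poisson variables; the level sets are indexed by `Fin m` to fit `indep_count`.
  let B : Fin m → Set Plane := fun k => f ⁻¹' {((e.symm k : f.range) : ℝ)}
  have hB : ∀ k, MeasurableSet (B k) := fun k => f.measurableSet_fiber _
  have hdis : Pairwise fun k l => Disjoint (B k) (B l) := fun k l hkl => by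
    refine Disjoint.preimage _ ?_
    rw [Set.disjoint_singleton]
    intro h
    exact hkl (e.symm.injective (Subtype.ext h))
  have hprod : ∀ ω, ∏ i ∈ Finset.range (N ω), f (X i ω)
      = ∏ k : Fin m, ((e.symm k : f.range) : ℝ) ^ count N X (B k) ω := by
    intro ω
    rw [e.symm.prod_comp (fun c : f.range => (c : ℝ) ^ count N X (f ⁻¹' {(c : ℝ)}) ω)]
    rw [Finset.prod_coe_sort f.range (fun c : ℝ => c ^ count N X (f ⁻¹' {c}) ω)]
    rw [← Finset.prod_fiberwise_of_maps_to (t := f.range) (g := fun i => f (X i ω))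
      (fun i _ => f.mem_range_self _)]
    refine Finset.prod_congr rfl fun c _ => ?_
    rw [Finset.prod_congr rfl (g := fun _ => c) (fun i hi => (Finset.mem_filter.mp hi).2),
      Finset.prod_const]
    simp only [count, Set.mem_preimage, Set.mem_singleton_iff]
  have hind := hΦ.indep_count m B hB hdis
  have hlaw : ∀ k, HasLaw (count N X (B k)) (poissonMeasure (Λ (B k)).toNNReal) μ :=
    fun k => hΦ.law_count _ (hB k)
  simp_rw [hprod]
  rw [hind.integral_fun_prod_comp (f := fun k n => ((e.symm k : f.range) : ℝ) ^ n)
    (fun k => (hlaw k).aemeasurable) (fun k => by measurability)]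
  have h1 : ∀ k, ∫ ω, ((e.symm k : f.range) : ℝ) ^ count N X (B k) ω ∂μ
      = Real.exp (-(Λ.real (B k) * (1 - ((e.symm k : f.range) : ℝ)))) := by
    intro k
    have := (hlaw k).integral_comp (f := fun n : ℕ => ((e.symm k : f.range) : ℝ) ^ n)
      (by measurability)
    simp only [Function.comp_def] at this
    rw [this, integral_pow_poissonMeasure]
    rfl
  simp_rw [h1]
  rw [← Real.exp_sum]
  congr 1
  rw [Finset.sum_neg_distrib]
  congr 1
  have h2 : ∫ x, (1 - f x) ∂Λ = ∑ c ∈ f.range, Λ.real (f ⁻¹' {c}) • (1 - c) := by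
    have h3 : ∀ x, 1 - f x = ∑ c ∈ f.range, (f ⁻¹' {c}).indicator (fun _ => 1 - c) x := by
      intro x
      rw [Finset.sum_eq_single_of_mem (f x) (f.mem_range_self x)]
      · rw [Set.indicator_of_mem (by simp)]
      · intro c _ hc
        rw [Set.indicator_of_notMem]
        simpa using hc.symm
    simp_rw [h3]
    rw [integral_finsetSum _ fun c _ =>
      (integrable_const (1 - c)).indicator (f.measurableSet_fiber c)]
    exact Finset.sum_congr rfl fun c _ => integral_indicator_const _ (f.measurableSet_fiber c)
  rw [h2, ← Finset.sum_coe_sort f.range (fun c : ℝ => Λ.real (f ⁻¹' {c}) • (1 - c)),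
    ← e.symm.sum_comp]
  rfl

/-- The probability generating functional of a Poisson process. -/
theorem IsPoissonProcess.integral_prod [IsProbabilityMeasure μ] {Λ : Measure Plane}
    [IsFiniteMeasure Λ] {N : Ω → ℕ} {X : ℕ → Ω → Plane} (hΦ : IsPoissonProcess μ Λ N X)
    {f : Plane → ℝ} (hf : Measurable f) (hf01 : ∀ x, f x ∈ Set.Icc (0 : ℝ) 1) :
    ∫ ω, ∏ i ∈ Finset.range (N ω), f (X i ω) ∂μ = Real.exp (-∫ x, (1 - f x) ∂Λ) := by
  have h0 : (0 : ℝ) ∈ Set.Icc (0 : ℝ) 1 := by simp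
  -- Approximating inside `[0, 1]` keeps all products bounded by `1`, so dominated convergence
  -- applies on both sides.
  let φ : ℕ → SimpleFunc Plane ℝ := fun n => SimpleFunc.approxOn f hf (Set.Icc 0 1) 0 h0 n
  have hφ : ∀ n x, φ n x ∈ Set.Icc (0 : ℝ) 1 := fun n x => SimpleFunc.approxOn_mem hf h0 n x
  have hlim : ∀ x, Tendsto (fun n => φ n x) atTop (𝓝 (f x)) := fun x =>
    SimpleFunc.tendsto_approxOn hf h0 (subset_closure (hf01 x))
  have hl : Tendsto (fun n => ∫ ω, ∏ i ∈ Finset.range (N ω), φ n (X i ω) ∂μ) atTop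
      (𝓝 (∫ ω, ∏ i ∈ Finset.range (N ω), f (X i ω) ∂μ)) := by
    refine tendsto_integral_of_dominated_convergence (fun _ => 1) (fun n => ?_)
      (integrable_const _) (fun n => ae_of_all _ fun ω => ?_) (ae_of_all _ fun ω => ?_)
    · exact (measurable_prod_range hΦ.measurable_card fun i =>
        (φ n).measurable.comp (hΦ.measurable_point i)).aestronglyMeasurable
    · rw [Real.norm_eq_abs, Finset.abs_prod]
      exact Finset.prod_le_one (fun i _ => abs_nonneg _) fun i _ => by
        rw [abs_of_nonneg (hφ _ _).1]; exact (hφ _ _).2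
    · exact tendsto_finsetProd _ fun i _ => hlim _
  have hr : Tendsto (fun n => Real.exp (-∫ x, (1 - φ n x) ∂Λ)) atTop
      (𝓝 (Real.exp (-∫ x, (1 - f x) ∂Λ))) := by
    refine (Real.continuous_exp.tendsto _).comp (Tendsto.neg ?_)
    refine tendsto_integral_of_dominated_convergence (fun _ => 1) (fun n => ?_)
      (integrable_const _) (fun n => ae_of_all _ fun x => ?_) (ae_of_all _ fun x => ?_)
    · exact (measurable_const.sub (φ n).measurable).aestronglyMeasurable
    · rw [Real.norm_eq_abs, abs_le]
      constructor <;> linarith [(hφ n x).1, (hφ n x).2]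
    · exact tendsto_const_nhds.sub (hlim x)
  simp_rw [hΦ.integral_prod_simpleFunc] at hl
  exact tendsto_nhds_unique hl hr

/-- Averaging over the marks of an independent thinning. -/
theorem IsIndependentThinning.integral_prod [IsProbabilityMeasure μ] {N : Ω → ℕ}
    {X : ℕ → Ω → Plane} {q : Plane → ℝ} {J : ℕ → Ω → Bool} (hN : Measurable N)
    (hX : ∀ i, Measurable (X i)) (hJ : IsIndependentThinning μ N X q J) (hq : Measurable q)
    (hq01 : ∀ x, q x ∈ Set.Icc (0 : ℝ) 1) {g : Plane → ℝ} (hg : Measurable g)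
    (hg01 : ∀ x, g x ∈ Set.Icc (0 : ℝ) 1) :
    ∫ ω, ∏ i ∈ Finset.range (N ω), (1 + (if J i ω = true then -g (X i ω) else 0)) ∂μ
      = ∫ ω, ∏ i ∈ Finset.range (N ω), (1 + -g (X i ω) * q (X i ω)) ∂μ := by
  have hle : sigmaPoints N X ≤ ‹MeasurableSpace Ω› :=
    (hN.prodMk (measurable_pi_lambda _ hX)).comap_le
  have hNX : Measurable[sigmaPoints N X] (fun ω => (N ω, fun i => X i ω)) :=
    comap_measurable _
  have hN' : Measurable[sigmaPoints N X] N := measurable_fst.comp hNX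
  have hX' : ∀ i, Measurable[sigmaPoints N X] (X i) := fun i =>
    (measurable_pi_apply i).comp (measurable_snd.comp hNX)
  have hJm : ∀ i, MeasurableSet {ω | J i ω = true} := fun i =>
    hJ.measurable_mark i (measurableSet_singleton true)
  have hgm : ∀ i, Measurable fun ω => -g (X i ω) := fun i => (hg.comp (hX i)).neg
  have hfm : ∀ i, Measurable fun ω => if J i ω = true then -g (X i ω) else 0 := fun i =>
    Measurable.ite (hJm i) (hgm i) measurable_const
  have hqm : ∀ i, Measurable fun ω => -g (X i ω) * q (X i ω) := fun i =>
    (hgm i).mul (hq.comp (hX i))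
  have hgq : ∀ x, -g x * q x ∈ Set.Icc (-1 : ℝ) 0 := fun x => by
    have := mul_le_one₀ (hg01 x).2 (hq01 x).1 (hq01 x).2
    have := mul_nonneg (hg01 x).1 (hq01 x).1
    constructor <;> linarith
  have hfb : ∀ i ω, (if J i ω = true then -g (X i ω) else 0) ∈ Set.Icc (-1 : ℝ) 0 := by
    intro i ω
    split_ifs
    · exact ⟨by linarith [(hg01 (X i ω)).2], by linarith [(hg01 (X i ω)).1]⟩
    · simp
  refine integral_eq_of_forall_fiber hN
    (integrable_prod_range hN (fun i => measurable_const.add (hfm i)) fun i ω => ?_)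
    (integrable_prod_range hN (fun i => measurable_const.add (hqm i)) fun i ω => ?_) fun n => ?_
  · rw [abs_le]; constructor <;> linarith [(hfb i ω).1, (hfb i ω).2]
  · rw [abs_le]; constructor <;> linarith [(hgq (X i ω)).1, (hgq (X i ω)).2]
  have hNn : MeasurableSet (N ⁻¹' {n}) := hN (measurableSet_singleton n)
  have hNn' : MeasurableSet[sigmaPoints N X] (N ⁻¹' {n}) := hN' (measurableSet_singleton n)
  -- With `N = n` fixed, expanding `∏ (1 + f i)` over subsets `S` leaves only joint selection events
  -- of the points in `S`, which is exactly what `cond_prob` describes.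
  have expand : ∀ f : ℕ → Ω → ℝ, (∀ i, Measurable (f i)) →
      (∀ i ω, f i ω ∈ Set.Icc (-1 : ℝ) 0) →
      ∫ ω in N ⁻¹' {n}, ∏ i ∈ Finset.range (N ω), (1 + f i ω) ∂μ
        = ∑ S ∈ (Finset.range n).powerset, ∫ ω in N ⁻¹' {n}, ∏ i ∈ S, f i ω ∂μ := by
    intro f hf hb
    rw [← integral_finsetSum]
    · refine setIntegral_congr_fun hNn fun ω hω => ?_
      have hω' : N ω = n := hω
      simp only [hω']
      exact Finset.prod_one_add _
    · intro S _
      refine Integrable.of_bound (Finset.measurable_prod _ fun i _ => hf i).aestronglyMeasurable 1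
        (ae_of_all _ fun ω => ?_)
      rw [Real.norm_eq_abs, Finset.abs_prod]
      exact Finset.prod_le_one (fun i _ => abs_nonneg _) fun i _ => by
        rw [abs_le]; exact ⟨(hb i ω).1, by linarith [(hb i ω).2]⟩
  rw [expand _ hfm hfb, expand _ hqm fun i ω => hgq _]
  refine Finset.sum_congr rfl fun S hS => ?_
  have hSn : ∀ i ∈ S, i < n := fun i hi =>
    Finset.mem_range.mp (Finset.mem_powerset.mp hS hi)
  -- The term for `S` factors as `φ * A`: `A` carries the marks, while `φ` depends on the
  -- configuration only and can be pulled out of the conditional expectation.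
  let A : Ω → ℝ := ({ω | ∀ i ∈ S, i < N ω ∧ J i ω = true}).indicator (fun _ => (1 : ℝ))
  let φ : Ω → ℝ := (N ⁻¹' {n}).indicator fun ω => ∏ i ∈ S, -g (X i ω)
  have hφm : StronglyMeasurable[sigmaPoints N X] φ := by
    refine StronglyMeasurable.indicator ?_ hNn'
    refine Measurable.stronglyMeasurable ?_
    exact Finset.measurable_prod (m := sigmaPoints N X) _
      fun i _ => (hg.comp (hX' i)).neg
  have hφb : ∀ ω, ‖φ ω‖ ≤ 1 := by
    intro ω
    refine (norm_indicator_le_norm_self _ _).trans ?_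
    rw [Real.norm_eq_abs, Finset.abs_prod]
    exact Finset.prod_le_one (fun i _ => abs_nonneg _) fun i _ => by
      rw [abs_neg, abs_of_nonneg (hg01 _).1]; exact (hg01 _).2
  have hAs : MeasurableSet {ω | ∀ i ∈ S, i < N ω ∧ J i ω = true} := by
    have : {ω | ∀ i ∈ S, i < N ω ∧ J i ω = true}
        = ⋂ i ∈ S, (N ⁻¹' Set.Ioi i ∩ {ω | J i ω = true}) := by
      ext ω; simp
    rw [this]
    exact Finset.measurableSet_biInter _ fun i _ => (hN measurableSet_Ioi).inter (hJm i)
  have hAi : Integrable A μ := (integrable_const (1 : ℝ)).indicator hAs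
  have hφA : Integrable (φ * A) μ :=
    hAi.bdd_mul (hφm.mono hle).aestronglyMeasurable (c := 1) (ae_of_all _ hφb)
  have key : ∫ ω, (φ * A) ω ∂μ
      = ∫ ω, φ ω * ∏ i ∈ S, (if i < N ω then q (X i ω) else 0) ∂μ := by
    rw [← integral_condExp hle]
    refine integral_congr_ae ?_
    filter_upwards [condExp_mul_of_stronglyMeasurable_left hφm hφA hAi, hJ.cond_prob S]
      with ω h1 h2
    rw [h1, Pi.mul_apply, h2]
  rw [← integral_indicator hNn, ← integral_indicator hNn]
  calc _ = ∫ ω, (φ * A) ω ∂μ := by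
        congr 1
        ext ω
        rw [Pi.mul_apply]
        by_cases hω : ω ∈ N ⁻¹' {n}
        · have hω' : N ω = n := hω
          simp only [φ, A, Set.indicator_of_mem hω]
          by_cases hA : ∀ i ∈ S, J i ω = true
          · rw [Set.indicator_of_mem (fun i hi => ⟨hω' ▸ hSn i hi, hA i hi⟩), mul_one]
            exact Finset.prod_congr rfl fun i hi => if_pos (hA i hi)
          · rw [Set.indicator_of_notMem (fun h => hA fun i hi => (h i hi).2), mul_zero]
            push Not at hA
            obtain ⟨i, hi, hJi⟩ := hA
            exact Finset.prod_eq_zero hi (if_neg hJi)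
        · simp [φ, Set.indicator_of_notMem hω]
    _ = _ := key
    _ = _ := by
        congr 1
        ext ω
        by_cases hω : ω ∈ N ⁻¹' {n}
        · have hω' : N ω = n := hω
          simp only [φ, Set.indicator_of_mem hω, ← Finset.prod_mul_distrib]
          refine Finset.prod_congr rfl fun i hi => ?_
          rw [if_pos (hω' ▸ hSn i hi)]
        · simp [φ, Set.indicator_of_notMem hω]

/-- Averaging over the fading. -/
theorem IsRayleighFading.laplaceTransform_interference [IsProbabilityMeasure μ] {α s : ℝ}
    (hs : 0 ≤ s) {N : Ω → ℕ} {X : ℕ → Ω → Plane} {J : ℕ → Ω → Bool} {h : ℕ → Ω → ℝ}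
    (hN : Measurable N) (hX : ∀ i, Measurable (X i)) (hJ : ∀ i, Measurable (J i))
    (hh : IsRayleighFading μ N X J h) (y : Plane) :
    laplaceTransform μ (interference α N X J h y) s
      = ∫ ω, ∏ i ∈ Finset.range (N ω),
          (if J i ω = true then (1 + s * ‖X i ω - y‖ ^ (-α))⁻¹ else 1) ∂μ := by
  let W : Type := ℕ × (ℕ → Plane) × (ℕ → Bool)
  let w : Ω → W := fun ω => (N ω, (fun i => X i ω), (fun i => J i ω))
  let H : Ω → (ℕ → ℝ) := fun ω i => h i ω
  have hw : Measurable w :=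
    hN.prodMk ((measurable_pi_lambda _ hX).prodMk (measurable_pi_lambda _ hJ))
  have hH : Measurable H := measurable_pi_lambda _ hh.measurable_gain
  have hl : Measurable fun x : Plane => ‖x - y‖ ^ (-α) :=
    (measurable_id.sub_const y).norm.pow_const _
  -- The factor of point `i` as a function of the network state and one gain, with the gain clipped
  -- at `0`. Fubini then allows the network state to be frozen while the independent gains are
  -- averaged.
  let k : ℕ → W → ℝ → ℝ := fun i v t =>
    if v.2.2 i = true then Real.exp (-(s * ‖v.2.1 i - y‖ ^ (-α) * max t 0)) else 1
  have hk01 : ∀ i v t, |k i v t| ≤ 1 := by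
    intro i v t
    simp only [k]
    split_ifs
    · rw [abs_of_pos (Real.exp_pos _), Real.exp_le_one_iff, neg_nonpos]
      positivity
    · simp
  have hkm : ∀ i, Measurable fun p : (ℕ → ℝ) × W => k i p.2 (p.1 i) := by
    intro i
    have h1 : Measurable fun p : (ℕ → ℝ) × W => p.2.2.2 i :=
      (measurable_pi_apply i).comp (measurable_snd.comp (measurable_snd.comp measurable_snd))
    have h2 : Measurable fun p : (ℕ → ℝ) × W => p.2.2.1 i :=
      (measurable_pi_apply i).comp (measurable_fst.comp (measurable_snd.comp measurable_snd))
    have h3 : Measurable fun p : (ℕ → ℝ) × W => p.1 i :=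
      (measurable_pi_apply i).comp measurable_fst
    refine Measurable.ite (h1 (measurableSet_singleton true)) ?_ measurable_const
    exact Real.measurable_exp.comp
      (((hl.comp h2).const_mul s).mul (h3.max measurable_const)).neg
  let F : (ℕ → ℝ) × W → ℝ := fun p => ∏ i ∈ Finset.range p.2.1, k i p.2 (p.1 i)
  have hFm : Measurable F :=
    measurable_prod_range (measurable_fst.comp measurable_snd) hkm
  have hprob : IsProbabilityMeasure (μ.map H) := Measure.isProbabilityMeasure_map hH.aemeasurable
  have hprob' : IsProbabilityMeasure (μ.map w) := Measure.isProbabilityMeasure_map hw.aemeasurable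
  have hFi : Integrable F ((μ.map H).prod (μ.map w)) :=
    integrable_prod_range (measurable_fst.comp measurable_snd) hkm fun i p => hk01 i p.2 _
  have hpos : ∀ᵐ ω ∂μ, ∀ i, 0 ≤ h i ω := by
    rw [ae_all_iff]
    intro i
    have := ae_nonneg_expMeasure
    rw [← (hh.law_gain i).map_eq] at this
    exact ae_of_ae_map (hh.measurable_gain i).aemeasurable this
  have hinner : ∀ v : W, ∫ ω, F (H ω, v) ∂μ
      = ∏ i ∈ Finset.range v.1,
        (if v.2.2 i = true then (1 + s * ‖v.2.1 i - y‖ ^ (-α))⁻¹ else 1) := by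
    intro v
    have hk : ∀ i, Measurable (k i v) := by
      intro i
      simp only [k]
      split_ifs
      · exact Real.measurable_exp.comp
          ((measurable_id.max measurable_const).const_mul _).neg
      · exact measurable_const
    simp only [F, H, Finset.prod_range]
    have hind : iIndepFun (fun i : Fin v.1 => h i) μ := hh.indep_gain.precomp Fin.val_injective
    rw [hind.integral_fun_prod_comp (f := fun i : Fin v.1 => k i v)
      (fun i => (hh.measurable_gain _).aemeasurable) (fun i => (hk i).aestronglyMeasurable)]
    refine Finset.prod_congr rfl fun i _ => ?_
    have := (hh.law_gain i).integral_comp (f := k i v) (hk i).aestronglyMeasurable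
    simp only [Function.comp_def] at this
    rw [this]
    by_cases hv : v.2.2 i = true
    · simp only [k, hv, if_true]
      exact integral_exp_neg_mul_max_expMeasure (by positivity)
    · simp only [k, hv]
      have : IsProbabilityMeasure (expMeasure 1) := isProbabilityMeasure_expMeasure one_pos
      simp
  calc laplaceTransform μ (interference α N X J h y) s
      = ∫ ω, F (H ω, w ω) ∂μ := by
        refine integral_congr_ae ?_
        filter_upwards [hpos] with ω hω
        simp only [interference, F, k, H, w]
        rw [Finset.mul_sum, Real.exp_sum, Finset.prod_filter]
        refine Finset.prod_congr rfl fun i _ => ?_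
        rw [max_eq_left (hω i)]
        congr 2
        ring
    _ = ∫ p, F p ∂((μ.map H).prod (μ.map w)) := by
        rw [← (indepFun_iff_map_prod_eq_prod_map_map hH.aemeasurable hw.aemeasurable).mp
          hh.indep_network, integral_map (hH.prodMk hw).aemeasurable hFm.aestronglyMeasurable]
    _ = ∫ v, ∫ η, F (η, v) ∂(μ.map H) ∂(μ.map w) := integral_prod_symm _ hFi
    _ = ∫ v, ∏ i ∈ Finset.range v.1,
          (if v.2.2 i = true then (1 + s * ‖v.2.1 i - y‖ ^ (-α))⁻¹ else 1) ∂(μ.map w) := by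
        congr 1
        ext v
        have hm : Measurable fun η => F (η, v) := hFm.comp measurable_prodMk_right
        rw [← hinner v, integral_map hH.aemeasurable hm.aestronglyMeasurable]
    _ = _ := by
        rw [integral_map hw.aemeasurable]
        refine (measurable_prod_range measurable_fst fun i => ?_).aestronglyMeasurable
        have h1 : Measurable fun v : W => v.2.2 i :=
          (measurable_pi_apply i).comp (measurable_snd.comp measurable_snd)
        have h2 : Measurable fun v : W => v.2.1 i :=
          (measurable_pi_apply i).comp (measurable_fst.comp measurable_snd)
        exact Measurable.ite (h1 (measurableSet_singleton true))
          (((hl.comp h2).const_mul s).const_add 1).inv measurable_const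

/-- The Laplace transform of the interference of an independently thinned Poisson process. -/
theorem laplaceTransform_interference_eq_exp [IsProbabilityMeasure μ] {Λ : Measure Plane}
    [IsFiniteMeasure Λ] {α s : ℝ} (hs : 0 ≤ s) {N : Ω → ℕ} {X : ℕ → Ω → Plane}
    {q : Plane → ℝ} {J : ℕ → Ω → Bool} {h : ℕ → Ω → ℝ} (hΦ : IsPoissonProcess μ Λ N X)
    (hJ : IsIndependentThinning μ N X q J) (hh : IsRayleighFading μ N X J h)
    (hq : Measurable q) (hq01 : ∀ x, q x ∈ Set.Icc (0 : ℝ) 1) (y : Plane) :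
    laplaceTransform μ (interference α N X J h y) s
      = Real.exp (-∫ x, (1 - (1 + s * ‖x - y‖ ^ (-α))⁻¹) * q x ∂Λ) := by
  let g : Plane → ℝ := fun x => 1 - (1 + s * ‖x - y‖ ^ (-α))⁻¹
  have hg : Measurable g :=
    ((((measurable_id.sub_const y).norm.pow_const _).const_mul s).const_add 1).inv.const_sub 1
  have hg01 : ∀ x, g x ∈ Set.Icc (0 : ℝ) 1 := fun x => by
    have h0 : 0 ≤ s * ‖x - y‖ ^ (-α) := by positivity
    have h1 : (1 + s * ‖x - y‖ ^ (-α))⁻¹ ≤ 1 := inv_le_one_of_one_le₀ (by linarith)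
    have h2 : 0 ≤ (1 + s * ‖x - y‖ ^ (-α))⁻¹ := by positivity
    exact ⟨by simp only [g]; linarith, by simp only [g]; linarith⟩
  rw [hh.laplaceTransform_interference hs hΦ.measurable_card hΦ.measurable_point
    hJ.measurable_mark]
  have h1 := hJ.integral_prod hΦ.measurable_card hΦ.measurable_point hq hq01 hg hg01
  have h2 := hΦ.integral_prod (f := fun x => 1 + -g x * q x)
    ((hg.neg.mul hq).const_add 1) (fun x => by
      have := mul_le_one₀ (hg01 x).2 (hq01 x).1 (hq01 x).2
      have := mul_nonneg (hg01 x).1 (hq01 x).1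
      constructor <;> linarith)
  calc _ = _ := by
        congr 1
        ext ω
        refine Finset.prod_congr rfl fun i _ => ?_
        show _ = 1 + (if J i ω = true then -g (X i ω) else 0)
        split_ifs
        · simp only [g]; ring
        · simp
    _ = _ := h1
    _ = _ := h2
    _ = _ := by
        congr 3
        ext x
        simp only [g]
        ring

end Model

end Jamming

/-! ### Geometry: reduction of the plane integral to a radial one. -/

namespace Jamming

theorem integral_one_div_sub_mul_cos {A B : ℝ} (h : |B| < A) (φ : ℝ) :
    ∫ θ in (-Real.pi)..Real.pi, 1 / (A - B * Real.cos (θ - φ))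
      = 2 * Real.pi / √(A ^ 2 - B ^ 2) := by
  have hA : 0 < A := (abs_nonneg B).trans_lt h
  have hAB : 0 < A ^ 2 - B ^ 2 := by
    have := sq_lt_sq' (by linarith [abs_nonneg B]) h
    rw [sq_abs] at this
    linarith
  set w := √(A ^ 2 - B ^ 2) with hw
  have hw0 : 0 < w := Real.sqrt_pos.mpr hAB
  have hw2 : w ^ 2 = A ^ 2 - B ^ 2 := Real.sq_sqrt hAB.le
  have hlow : ∀ b t : ℝ, |b| < A → |t| ≤ 1 → 0 < A - b * t := fun b t hb ht => by
    have h1 : b * t ≤ |b| * |t| := by rw [← abs_mul]; exact le_abs_self _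
    have h2 : |b| * |t| ≤ |b| * 1 := mul_le_mul_of_nonneg_left ht (abs_nonneg b)
    linarith
  have hden : ∀ x, 0 < A - B * Real.cos x := fun x => hlow B _ h (Real.abs_cos_le_one x)
  have hden' : ∀ x, 0 < A + w - B * Real.cos x := fun x => by linarith [hden x]
  -- A rearranged half-angle antiderivative. Unlike the one in `tan (θ / 2)` it has no jumps, as `A
  -- + w - B cos` never vanishes. Its arctangent part is periodic, so over a full period only the
  -- linear term contributes, giving `2π / w`.
  let F : ℝ → ℝ := fun θ => (1 / w) * ((θ - φ) + 2 * Real.arctan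
    (B * Real.sin (θ - φ) / (A + w - B * Real.cos (θ - φ))))
  have hF : ∀ θ, HasDerivAt F (1 / (A - B * Real.cos (θ - φ))) θ := by
    intro θ
    have h1 : HasDerivAt (fun θ : ℝ => θ - φ) 1 θ := (hasDerivAt_id θ).sub_const φ
    have h2 := ((h1.sin.const_mul B).div ((h1.cos.const_mul B).const_sub (A + w))
      (hden' _).ne').arctan
    convert! (h1.add (h2.const_mul 2)).const_mul (1 / w) using 1
    simp only [Pi.div_apply]
    have hc := Real.sin_sq_add_cos_sq (θ - φ)
    have hd := hden (θ - φ)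
    have hd' := hden' (θ - φ)
    set c := Real.cos (θ - φ)
    set d := Real.sin (θ - φ)
    -- Uses `B² = A² - w² = (A - w) * (A + w)` to extract the factor `A + w`.
    have hsum : (A + w - B * c) ^ 2 + (B * d) ^ 2 = 2 * (A + w) * (A - B * c) := by
      linear_combination B ^ 2 * hc + hw2
    have h5 : 1 + (B * d / (A + w - B * c)) ^ 2
        = 2 * (A + w) * (A - B * c) / (A + w - B * c) ^ 2 := by
      rw [← hsum]
      field_simp
    have hAw : 0 < A + w := by linarith
    rw [h5]
    field_simp
    linear_combination B ^ 2 * hc + hw2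
  rw [intervalIntegral.integral_eq_sub_of_hasDerivAt (fun θ _ => hF θ)]
  · have hs : Real.sin (Real.pi - φ) = Real.sin (-Real.pi - φ) := by
      rw [← Real.sin_sub_two_pi (Real.pi - φ)]; congr 1; ring
    have hc : Real.cos (Real.pi - φ) = Real.cos (-Real.pi - φ) := by
      rw [← Real.cos_sub_two_pi (Real.pi - φ)]; congr 1; ring
    simp only [F, hs, hc]
    ring
  · refine Continuous.intervalIntegrable ?_ _ _
    exact continuous_const.div (by fun_prop) fun θ => (hden _).ne'

/-- The quantity `(s + r² + ρ²)² - 4 r² ρ²`. -/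
noncomputable def radialDisc (s ρ r : ℝ) : ℝ :=
  r ^ 4 + 2 * (s - ρ ^ 2) * r ^ 2 + (s + ρ ^ 2) ^ 2

/-- A sum of two squares, the second positive unless `ρ = 0`, when the first is at least `s²`.
Including `ρ = 0` is what makes the radial integral continuous there. -/
theorem radialDisc_pos {s : ℝ} (hs : 0 < s) (ρ r : ℝ) : 0 < radialDisc s ρ r := by
  have h : radialDisc s ρ r = (r ^ 2 + s - ρ ^ 2) ^ 2 + 4 * s * ρ ^ 2 := by
    unfold radialDisc; ring
  rw [h]
  rcases eq_or_ne ρ 0 with rfl | hρ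
  · have : 0 < r ^ 2 + s - 0 ^ 2 := by nlinarith [sq_nonneg r]
    positivity
  · have : 0 < ρ ^ 2 := by positivity
    positivity

theorem norm_polarCoord_symm_sub_sq (c : ℂ) (p : ℝ × ℝ) :
    ‖Complex.polarCoord.symm p - c‖ ^ 2
      = p.1 ^ 2 + ‖c‖ ^ 2 - 2 * p.1 * ‖c‖ * Real.cos (p.2 - c.arg) := by
  have h1 := Complex.norm_mul_cos_arg c
  have h2 := Complex.norm_mul_sin_arg c
  rw [Complex.polarCoord_symm_apply, ← Complex.normSq_eq_norm_sq, ← Complex.normSq_eq_norm_sq,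
    Complex.normSq_apply, Complex.normSq_apply, Real.cos_sub]
  simp only [Complex.sub_re, Complex.sub_im, Complex.mul_re, Complex.mul_im, Complex.add_re,
    Complex.add_im, Complex.ofReal_re, Complex.ofReal_im, Complex.I_re, Complex.I_im]
  have h3 := Real.sin_sq_add_cos_sq p.2
  linear_combination p.1 ^ 2 * h3 + 2 * p.1 * Real.cos p.2 * h1 + 2 * p.1 * Real.sin p.2 * h2

/-- By the law of cosines the polar integrand has the form `1 / (A - B cos (θ - arg c))` with `A² -
B² = radialDisc s ‖c‖ r`. Working in `ℂ` gives access to polar coordinates; an isometry carries the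
result to the plane. -/
theorem integral_radial_complex {s R : ℝ} (hs : 0 < s) (hR : 0 ≤ R) {Q : ℝ → ℝ}
    (hQ : Measurable Q) (hQ01 : ∀ r, Q r ∈ Set.Icc (0 : ℝ) 1) (hQR : ∀ r, R < r → Q r = 0)
    (c : ℂ) :
    ∫ z : ℂ, Q ‖z‖ * (s / (s + ‖z - c‖ ^ 2))
      = Real.pi * s * ∫ r in (0 : ℝ)..R, Q r * (2 * r / √(radialDisc s ‖c‖ r)) := by
  rw [← Complex.integral_comp_polarCoord_symm]
  let g : ℝ × ℝ → ℝ := fun p =>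
    p.1 * (Q |p.1| * (s / (s + ‖Complex.polarCoord.symm p - c‖ ^ 2)))
  have hgm : Measurable g := by
    have h1 : Measurable fun p : ℝ × ℝ => Complex.polarCoord.symm p := by
      simp only [Complex.polarCoord_symm_apply]
      fun_prop
    have h2 : Measurable fun p : ℝ × ℝ => Q |p.1| :=
      hQ.comp (continuous_abs.measurable.comp measurable_fst)
    exact measurable_fst.mul
      (h2.mul ((((h1.sub_const c).norm.pow_const 2).const_add s).const_div s))
  have hg0 : ∀ p : ℝ × ℝ, R < p.1 → g p = 0 := fun p hp => by
    simp only [g]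
    rw [hQR _ (hp.trans_le (le_abs_self _))]
    simp
  have hset : polarCoord.target = Set.Ioi (0 : ℝ) ×ˢ Set.Ioo (-Real.pi) Real.pi := rfl
  -- The integrand vanishes for radius beyond `R` and is bounded by `R` on the remaining rectangle
  -- of finite area.
  have hint : IntegrableOn g (Set.Ioi (0 : ℝ) ×ˢ Set.Ioo (-Real.pi) Real.pi)
      (volume.prod volume) := by
    have h1 : IntegrableOn g (Set.Ioc 0 R ×ˢ Set.Ioo (-Real.pi) Real.pi)
        (volume.prod volume) := by
      refine Measure.integrableOn_of_bounded (M := R) ?_ hgm.aestronglyMeasurable ?_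
      · rw [Measure.prod_prod]
        simp [ENNReal.mul_eq_top]
      · refine (ae_restrict_iff' (measurableSet_Ioc.prod measurableSet_Ioo)).mpr
          (ae_of_all _ fun p hp => ?_)
        have hp1 := hp.1
        have h2 : s / (s + ‖Complex.polarCoord.symm p - c‖ ^ 2) ≤ 1 :=
          div_le_one_of_le₀ (by nlinarith [sq_nonneg ‖Complex.polarCoord.symm p - c‖])
            (by positivity)
        have h3 : 0 ≤ s / (s + ‖Complex.polarCoord.symm p - c‖ ^ 2) := by positivity
        have h4 := hQ01 |p.1|
        rw [Real.norm_of_nonneg (mul_nonneg hp1.1.le (mul_nonneg h4.1 h3))]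
        calc g p ≤ p.1 * 1 := mul_le_mul_of_nonneg_left (mul_le_one₀ h4.2 h3 h2) hp1.1.le
          _ ≤ R := by linarith [hp1.2]
    refine h1.of_forall_sdiff_eq_zero (measurableSet_Ioi.prod measurableSet_Ioo) fun p hp => ?_
    refine hg0 p (not_le.mp fun hle => hp.2 ⟨⟨hp.1.1, hle⟩, hp.1.2⟩)
  calc ∫ p in polarCoord.target, p.1 • (Q ‖Complex.polarCoord.symm p‖ *
        (s / (s + ‖Complex.polarCoord.symm p - c‖ ^ 2)))
      = ∫ p in Set.Ioi (0 : ℝ) ×ˢ Set.Ioo (-Real.pi) Real.pi, g p ∂(volume.prod volume) := by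
        rw [hset, Measure.volume_eq_prod]
        simp only [Complex.norm_polarCoord_symm, smul_eq_mul, g]
    _ = ∫ r in Set.Ioi (0 : ℝ), ∫ θ in Set.Ioo (-Real.pi) Real.pi, g (r, θ) :=
        setIntegral_prod _ hint
    _ = ∫ r in Set.Ioi (0 : ℝ), Real.pi * s * (Q r * (2 * r / √(radialDisc s ‖c‖ r))) := by
        refine setIntegral_congr_fun measurableSet_Ioi fun r hr => ?_
        have hr0 : 0 < r := hr
        have hgr : ∀ θ, g (r, θ) = r * Q r * s *
            (1 / ((s + r ^ 2 + ‖c‖ ^ 2) - (2 * r * ‖c‖) * Real.cos (θ - c.arg))) := by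
          intro θ
          simp only [g]
          rw [norm_polarCoord_symm_sub_sq, abs_of_pos hr0,
            show s + (r ^ 2 + ‖c‖ ^ 2 - 2 * r * ‖c‖ * Real.cos (θ - c.arg))
              = s + r ^ 2 + ‖c‖ ^ 2 - 2 * r * ‖c‖ * Real.cos (θ - c.arg) by ring]
          ring
        have hB : |2 * r * ‖c‖| < s + r ^ 2 + ‖c‖ ^ 2 := by
          rw [abs_of_nonneg (by positivity)]
          nlinarith [sq_nonneg (r - ‖c‖)]
        simp_rw [hgr]
        rw [integral_const_mul, ← integral_Ioc_eq_integral_Ioo,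
          ← intervalIntegral.integral_of_le (by linarith [Real.pi_pos]),
          integral_one_div_sub_mul_cos hB]
        have hd : (s + r ^ 2 + ‖c‖ ^ 2) ^ 2 - (2 * r * ‖c‖) ^ 2 = radialDisc s ‖c‖ r := by
          unfold radialDisc; ring
        rw [hd]
        ring
    _ = ∫ r in Set.Ioc (0 : ℝ) R, Real.pi * s * (Q r * (2 * r / √(radialDisc s ‖c‖ r))) := by
        refine setIntegral_eq_of_subset_of_forall_sdiff_eq_zero measurableSet_Ioi
          Set.Ioc_subset_Ioi_self fun r hr => ?_
        rw [hQR r (not_le.mp fun hle => hr.2 ⟨hr.1, hle⟩)]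
        simp
    _ = _ := by
        rw [integral_const_mul, ← intervalIntegral.integral_of_le hR]

theorem integral_radial_plane {s R : ℝ} (hs : 0 < s) (hR : 0 ≤ R) {Q : ℝ → ℝ}
    (hQ : Measurable Q) (hQ01 : ∀ r, Q r ∈ Set.Icc (0 : ℝ) 1) (hQR : ∀ r, R < r → Q r = 0)
    (y : Plane) :
    ∫ x : Plane, Q ‖x‖ * (s / (s + ‖x - y‖ ^ 2))
      = Real.pi * s * ∫ r in (0 : ℝ)..R, Q r * (2 * r / √(radialDisc s ‖y‖ r)) := by
  let e : ℂ ≃ₗᵢ[ℝ] Plane := Complex.orthonormalBasisOneI.repr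
  rw [← e.measurePreserving.integral_comp e.toHomeomorph.measurableEmbedding]
  have h1 : ∀ z : ℂ, ‖e z - y‖ = ‖z - e.symm y‖ := fun z => by
    rw [← e.norm_map (z - e.symm y), map_sub, e.apply_symm_apply]
  simp_rw [e.norm_map, h1]
  rw [integral_radial_complex hs hR hQ hQ01 hQR, e.symm.norm_map]

/-! ### Antiderivatives of the radial kernel and the closed form. -/

section ClosedForm

variable {s : ℝ}

theorem hasDerivAt_sqrt_radialDisc (hs : 0 < s) (ρ r : ℝ) :
    HasDerivAt (fun r => √(radialDisc s ρ r))
      ((s + r ^ 2 - ρ ^ 2) * (2 * r / √(radialDisc s ρ r))) r := by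
  have h : HasDerivAt (radialDisc s ρ) (4 * r ^ 3 + 2 * (s - ρ ^ 2) * (2 * r)) r := by
    have h1 := ((hasDerivAt_pow 4 r).add ((hasDerivAt_pow 2 r).const_mul (2 * (s - ρ ^ 2)))
      ).add_const ((s + ρ ^ 2) ^ 2)
    convert! h1 using 1
    norm_num
  convert! h.sqrt (radialDisc_pos hs ρ r).ne' using 1
  have := Real.sqrt_pos.mpr (radialDisc_pos hs ρ r)
  field_simp
  ring

/-- If `u` is the argument of `arsinh`, then `1 + u² = radialDisc s ρ r / (2ρ√s)²`, so the factor
`2ρ√s` cancels against `u'`. -/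
theorem hasDerivAt_asTerm (hs : 0 < s) {ρ : ℝ} (hρ : 0 < ρ) (r : ℝ) :
    HasDerivAt (fun r => asTerm r s ρ) (2 * r / √(radialDisc s ρ r)) r := by
  have hss : 0 < √s := Real.sqrt_pos.mpr hs
  have hk : 0 < 2 * ρ * √s := by positivity
  have h1 : HasDerivAt (fun r : ℝ => (s + r ^ 2 - ρ ^ 2) / (2 * ρ * √s))
      (2 * r / (2 * ρ * √s)) r := by
    have := (((hasDerivAt_pow 2 r).const_add s).sub_const (ρ ^ 2)).div_const (2 * ρ * √s)
    convert! this using 1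
    norm_num
  have h2 : √(1 + ((s + r ^ 2 - ρ ^ 2) / (2 * ρ * √s)) ^ 2)
      = √(radialDisc s ρ r) / (2 * ρ * √s) := by
    rw [eq_div_iff hk.ne', ← Real.sqrt_sq hk.le, ← Real.sqrt_mul (by positivity),
      Real.sqrt_sq hk.le]
    congr 1
    have := Real.sq_sqrt hs.le
    field_simp
    unfold radialDisc
    linear_combination 4 * ρ ^ 2 * this
  convert! h1.arsinh using 1
  rw [h2, smul_eq_mul]
  have := Real.sqrt_pos.mpr (radialDisc_pos hs ρ r)
  field_simp

/-- Source of the logarithm in the closed form: `sinh (log t) = (t - t⁻¹) / 2` at `t = √s / ρ`. -/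
theorem asTerm_zero (hs : 0 < s) {ρ : ℝ} (hρ : 0 < ρ) :
    asTerm 0 s ρ = Real.log (√s / ρ) := by
  have hss : 0 < √s := Real.sqrt_pos.mpr hs
  rw [← Real.arsinh_sinh (Real.log (√s / ρ)), Real.sinh_log (by positivity), asTerm]
  congr 1
  have := Real.sq_sqrt hs.le
  field_simp
  linear_combination -this

/-- Writes `r² - R₁²` as `(s + r² - ρ²) - (s + R₁² - ρ²)`. For `R₁ = R₂` division by zero makes
`PsiI` and its derivative `0`, matching the convention for the empty annulus. -/
theorem hasDerivAt_PsiI (hs : 0 < s) {ρ : ℝ} (hρ : 0 < ρ) (R₁ R₂ r : ℝ) :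
    HasDerivAt (fun r => PsiI R₁ R₂ r s ρ)
      ((r ^ 2 - R₁ ^ 2) / (R₂ ^ 2 - R₁ ^ 2) * (2 * r / √(radialDisc s ρ r))) r := by
  convert! ((hasDerivAt_sqrt_radialDisc hs ρ r).div_const (R₂ ^ 2 - R₁ ^ 2)).sub
    ((hasDerivAt_asTerm hs hρ r).const_mul ((s + R₁ ^ 2 - ρ ^ 2) / (R₂ ^ 2 - R₁ ^ 2))) using 1
  ring

theorem hasDerivAt_PsiD (hs : 0 < s) {ρ : ℝ} (hρ : 0 < ρ) (R₁ R₂ r : ℝ) :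
    HasDerivAt (fun r => PsiD R₁ R₂ r s ρ)
      ((R₂ ^ 2 - r ^ 2) / (R₂ ^ 2 - R₁ ^ 2) * (2 * r / √(radialDisc s ρ r))) r := by
  convert! ((hasDerivAt_asTerm hs hρ r).const_mul ((s + R₂ ^ 2 - ρ ^ 2) / (R₂ ^ 2 - R₁ ^ 2))).sub
    ((hasDerivAt_sqrt_radialDisc hs ρ r).div_const (R₂ ^ 2 - R₁ ^ 2)) using 1
  ring

theorem continuous_radialKernel (hs : 0 < s) :
    Continuous fun p : ℝ × ℝ => 2 * p.2 / √(radialDisc s p.1 p.2) := by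
  refine Continuous.div (by fun_prop) ?_ fun p =>
    (Real.sqrt_pos.mpr (radialDisc_pos hs p.1 p.2)).ne'
  unfold radialDisc
  fun_prop

theorem continuous_radialKernel_right (hs : 0 < s) (ρ : ℝ) :
    Continuous fun r : ℝ => 2 * r / √(radialDisc s ρ r) :=
  (continuous_radialKernel hs).comp (continuous_const.prodMk continuous_id)

theorem Policy.continuous_prob (R₁ R₂ : ℝ) (Ξ : Policy) : Continuous (Ξ.prob 2 R₁ R₂) := by
  cases Ξ with
  | E p => exact continuous_const
  | I => unfold Policy.prob; simp only [Real.rpow_two]; fun_prop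
  | D => unfold Policy.prob; simp only [Real.rpow_two]; fun_prop

/-- The exponent of the closed form as a radial integral. -/
noncomputable def radialIntegral (R₁ R₂ s : ℝ) (Ξ : Policy) (ρ : ℝ) : ℝ :=
  (∫ r in (0 : ℝ)..R₁, 2 * r / √(radialDisc s ρ r))
    + ∫ r in R₁..R₂, Ξ.prob 2 R₁ R₂ r * (2 * r / √(radialDisc s ρ r))

theorem continuous_radialIntegral (hs : 0 < s) (R₁ R₂ : ℝ) (Ξ : Policy) :
    Continuous (radialIntegral R₁ R₂ s Ξ) := by
  refine Continuous.add ?_ ?_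
  · exact intervalIntegral.continuous_parametric_intervalIntegral_of_continuous'
      (continuous_radialKernel hs) _ _
  · refine intervalIntegral.continuous_parametric_intervalIntegral_of_continuous' ?_ _ _
    exact ((Ξ.continuous_prob R₁ R₂).comp continuous_snd).mul (continuous_radialKernel hs)

theorem closedForm_eq_exp_radialIntegral (hs : 0 < s) (lam R₁ R₂ : ℝ) (Ξ : Policy) {ρ : ℝ}
    (hρ : 0 < ρ) :
    closedForm lam R₁ R₂ s Ξ ρ
      = Real.exp (-(lam * Real.pi * s * radialIntegral R₁ R₂ s Ξ ρ)) := by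
  have hk := continuous_radialKernel_right hs ρ
  have hint : ∀ a b : ℝ, ∫ r in a..b, 2 * r / √(radialDisc s ρ r)
      = asTerm b s ρ - asTerm a s ρ := fun a b =>
    intervalIntegral.integral_eq_sub_of_hasDerivAt (fun r _ => hasDerivAt_asTerm hs hρ r)
      (hk.intervalIntegrable _ _)
  have hpk : ∀ Ξ' : Policy, IntervalIntegrable
      (fun r => Ξ'.prob 2 R₁ R₂ r * (2 * r / √(radialDisc s ρ r))) volume R₁ R₂ := fun Ξ' =>
    ((Ξ'.continuous_prob R₁ R₂).mul hk).intervalIntegrable _ _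
  have h0 := asTerm_zero hs hρ
  cases Ξ with
  | E p =>
    simp only [closedForm, radialIntegral, Policy.prob]
    rw [intervalIntegral.integral_const_mul, hint, hint, h0]
    congr 2
    ring
  | I =>
    have hi := hpk .I
    simp only [closedForm, radialIntegral]
    simp only [Policy.prob, Real.rpow_two] at hi ⊢
    rw [intervalIntegral.integral_eq_sub_of_hasDerivAt
      (fun r _ => hasDerivAt_PsiI hs hρ R₁ R₂ r) hi, hint, h0]
    congr 2
    ring
  | D =>
    have hi := hpk .D
    simp only [closedForm, radialIntegral]
    simp only [Policy.prob, Real.rpow_two] at hi ⊢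
    rw [intervalIntegral.integral_eq_sub_of_hasDerivAt
      (fun r _ => hasDerivAt_PsiD hs hρ R₁ R₂ r) hi, hint, h0]
    congr 2
    ring

end ClosedForm

/-- The selection probability as a function of the distance to the origin. -/
noncomputable def jamProbRadial (R₁ R₂ : ℝ) (Ξ : Policy) (r : ℝ) : ℝ :=
  if r ≤ R₁ then 1 else if r ≤ R₂ then Ξ.prob 2 R₁ R₂ r else 0

theorem measurable_jamProbRadial (R₁ R₂ : ℝ) (Ξ : Policy) :
    Measurable (jamProbRadial R₁ R₂ Ξ) :=
  Measurable.ite measurableSet_Iic measurable_const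
    (Measurable.ite measurableSet_Iic (Ξ.continuous_prob R₁ R₂).measurable measurable_const)

theorem jamProbRadial_mem_Icc {R₁ R₂ : ℝ} (hR₁ : 0 < R₁) {Ξ : Policy}
    (hΞ : ∀ p : ℝ, Ξ = Policy.E p → 0 ≤ p ∧ p ≤ 1) (r : ℝ) :
    jamProbRadial R₁ R₂ Ξ r ∈ Set.Icc (0 : ℝ) 1 := by
  unfold jamProbRadial
  split_ifs with h1 h2
  · simp
  · have h1' : R₁ < r := not_le.mp h1
    have ha : R₁ ^ 2 < r ^ 2 := by nlinarith
    have hb : r ^ 2 ≤ R₂ ^ 2 := by nlinarith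
    cases Ξ with
    | E p => exact hΞ p rfl
    | I =>
      simp only [Policy.prob, Real.rpow_two]
      exact ⟨div_nonneg (by linarith) (by linarith),
        div_le_one_of_le₀ (by linarith) (by linarith)⟩
    | D =>
      simp only [Policy.prob, Real.rpow_two]
      exact ⟨div_nonneg (by linarith) (by linarith),
        div_le_one_of_le₀ (by linarith) (by linarith)⟩
  · simp

theorem integral_jamProbRadial {R₁ R₂ s : ℝ} (hs : 0 < s) (hR₁ : 0 < R₁) (hR₁₂ : R₁ ≤ R₂)
    (Ξ : Policy) (ρ : ℝ) :
    ∫ r in (0 : ℝ)..R₂, jamProbRadial R₁ R₂ Ξ r * (2 * r / √(radialDisc s ρ r))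
      = radialIntegral R₁ R₂ s Ξ ρ := by
  have hk := continuous_radialKernel_right hs ρ
  -- The half-open intervals `(0, R₁]` and `(R₁, R₂]` match the inequalities defining the selection
  -- probability, so agreement is exact on each.
  have e1 : Set.EqOn (fun r => jamProbRadial R₁ R₂ Ξ r * (2 * r / √(radialDisc s ρ r)))
      (fun r => 2 * r / √(radialDisc s ρ r)) (Set.uIoc 0 R₁) := fun r hr => by
    rw [Set.uIoc_of_le hR₁.le] at hr
    simp only [jamProbRadial, if_pos hr.2, one_mul]
  have e2 : Set.EqOn (fun r => jamProbRadial R₁ R₂ Ξ r * (2 * r / √(radialDisc s ρ r)))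
      (fun r => Ξ.prob 2 R₁ R₂ r * (2 * r / √(radialDisc s ρ r))) (Set.uIoc R₁ R₂) :=
    fun r hr => by
      rw [Set.uIoc_of_le hR₁₂] at hr
      simp only [jamProbRadial, if_neg (not_le.mpr hr.1), if_pos hr.2]
  have i1 := hk.intervalIntegrable (μ := volume) 0 R₁
  have i2 := ((Ξ.continuous_prob R₁ R₂).mul hk).intervalIntegrable (μ := volume) R₁ R₂
  rw [← intervalIntegral.integral_add_adjacent_intervals
    ((intervalIntegrable_congr e1).mpr i1) ((intervalIntegrable_congr e2).mpr i2), radialIntegral]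
  congr 1
  · exact intervalIntegral.integral_congr_ae (ae_of_all _ e1)
  · exact intervalIntegral.integral_congr_ae (ae_of_all _ e2)

theorem integral_jamProb_mul_gain {lam D R₁ R₂ s : ℝ} (hlam : 0 ≤ lam) (hs : 0 < s)
    (hR₁ : 0 < R₁) (hR₁₂ : R₁ ≤ R₂) (hR₂ : R₂ ≤ D) {Ξ : Policy}
    (hΞ : ∀ p : ℝ, Ξ = Policy.E p → 0 ≤ p ∧ p ≤ 1) (y : Plane) :
    ∫ x, (1 - (1 + s * ‖x - y‖ ^ (-2 : ℝ))⁻¹) * jamProb 2 R₁ R₂ Ξ x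
        ∂(ENNReal.ofReal lam • (volume.restrict (Metric.closedBall (0 : Plane) D)))
      = lam * Real.pi * s * radialIntegral R₁ R₂ s Ξ ‖y‖ := by
  have hzero : ∀ x : Plane, x ∉ Metric.closedBall (0 : Plane) D →
      (1 - (1 + s * ‖x - y‖ ^ (-2 : ℝ))⁻¹) * jamProb 2 R₁ R₂ Ξ x = 0 := by
    intro x hx
    rw [mem_closedBall_zero_iff, not_le] at hx
    rw [jamProb, if_neg (by linarith), if_neg (by linarith), mul_zero]
  rw [integral_smul_measure, ENNReal.toReal_ofReal hlam,
    setIntegral_eq_integral_of_forall_compl_eq_zero hzero]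
  have hae : ∀ᵐ x : Plane, (1 - (1 + s * ‖x - y‖ ^ (-2 : ℝ))⁻¹) * jamProb 2 R₁ R₂ Ξ x
      = jamProbRadial R₁ R₂ Ξ ‖x‖ * (s / (s + ‖x - y‖ ^ 2)) := by
    -- At `x = y` the identity can fail: `0 ^ (-2)` is `0` by default, so the gain factor is `0`
    -- there, whereas `s / (s + 0) = 1`.
    filter_upwards [Measure.ae_ne volume y] with x hx
    have hpos : 0 < ‖x - y‖ := norm_pos_iff.mpr (sub_ne_zero.mpr hx)
    have hj : jamProb 2 R₁ R₂ Ξ x = jamProbRadial R₁ R₂ Ξ ‖x‖ := rfl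
    rw [hj, Real.rpow_neg hpos.le, Real.rpow_two, mul_comm]
    congr 1
    field_simp
    ring
  rw [integral_congr_ae hae, integral_radial_plane hs (hR₁.le.trans hR₁₂)
    (measurable_jamProbRadial R₁ R₂ Ξ) (jamProbRadial_mem_Icc hR₁ hΞ) (fun r hr => by
      rw [jamProbRadial, if_neg (by linarith), if_neg (by linarith)]),
    integral_jamProbRadial hs hR₁ hR₁₂, smul_eq_mul]
  ring

end Jamming

theorem theorem1 {Ω : Type*} [MeasurableSpace Ω] (μ : Measure Ω) [IsProbabilityMeasure μ]
    (lam D R₁ R₂ s : ℝ) (hlam : 0 ≤ lam) (hR₁ : 0 < R₁) (hR₁₂ : R₁ ≤ R₂) (hR₂ : R₂ ≤ D)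
    (hs : 0 < s)
    (Ξ : Jamming.Policy) (hΞ : ∀ p : ℝ, Ξ = Jamming.Policy.E p → 0 ≤ p ∧ p ≤ 1)
    (N : Ω → ℕ) (X : ℕ → Ω → Jamming.Plane) (J : ℕ → Ω → Bool) (h : ℕ → Ω → ℝ)
    (hΦ : Jamming.IsPoissonProcess μ
      (ENNReal.ofReal lam • (volume.restrict (Metric.closedBall (0 : Jamming.Plane) D))) N X)
    (hJ : Jamming.IsIndependentThinning μ N X (Jamming.jamProb 2 R₁ R₂ Ξ) J)
    (hh : Jamming.IsRayleighFading μ N X J h)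
    (y : Jamming.Plane) (hy : y ∈ Metric.closedBall (0 : Jamming.Plane) D) :
    (y ≠ 0 →
      Jamming.laplaceTransform μ (Jamming.interference 2 N X J h y) s
        = Jamming.closedForm lam R₁ R₂ s Ξ ‖y‖) ∧
    (y = 0 →
      Tendsto (fun ρ : ℝ => Jamming.closedForm lam R₁ R₂ s Ξ ρ) (𝓝[>] 0)
        (𝓝 (Jamming.laplaceTransform μ (Jamming.interference 2 N X J h y) s))) := by
  have hk := (isCompact_closedBall (0 : Jamming.Plane) D).measure_lt_top (μ := volume)
  have hfin : IsFiniteMeasure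
      (ENNReal.ofReal lam • (volume.restrict (Metric.closedBall (0 : Jamming.Plane) D))) :=
    ⟨by simpa using ENNReal.mul_lt_top ENNReal.ofReal_lt_top hk⟩
  have hL : Jamming.laplaceTransform μ (Jamming.interference 2 N X J h y) s
      = Real.exp (-(lam * Real.pi * s * Jamming.radialIntegral R₁ R₂ s Ξ ‖y‖)) := by
    rw [Jamming.laplaceTransform_interference_eq_exp hs.le hΦ hJ hh
      ((Jamming.measurable_jamProbRadial R₁ R₂ Ξ).comp measurable_norm)
      (fun x => Jamming.jamProbRadial_mem_Icc hR₁ hΞ ‖x‖),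
      Jamming.integral_jamProb_mul_gain hlam hs hR₁ hR₁₂ hR₂ hΞ]
  refine ⟨fun hy0 => ?_, fun hy0 => ?_⟩
  · rw [hL, Jamming.closedForm_eq_exp_radialIntegral hs lam R₁ R₂ Ξ (norm_pos_iff.mpr hy0)]
  · rw [hL, hy0, norm_zero]
    have hc : Continuous fun ρ : ℝ =>
        Real.exp (-(lam * Real.pi * s * Jamming.radialIntegral R₁ R₂ s Ξ ρ)) :=
      Real.continuous_exp.comp
        ((Jamming.continuous_radialIntegral hs R₁ R₂ Ξ).const_mul _).neg
    -- The radial-integral expression is continuous at `0` and agrees with the closed form for `ρ >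
    -- 0`, which is all that a right-hand limit sees.
    refine ((hc.tendsto 0).mono_left nhdsWithin_le_nhds).congr' ?_
    filter_upwards [self_mem_nhdsWithin] with ρ hρ
    exact (Jamming.closedForm_eq_exp_radialIntegral hs lam R₁ R₂ Ξ hρ).symm
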